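/- Let $p$ be a prime, let $e$ be an odd prime such that $p$ is a primitive root modulo $e$, and let $t\ge 1$ be an integer. Put $q=p^{(e-1)t}$. The van Lint–Schrijver graph $\mathrm{vLS}(p,e,t)$ has the elements of the finite field $\mathrm{GF}(q)$ as vertices, two distinct vertices $x,y$ being adjacent if and only if $x-y$ is an $e$-th power in $\mathrm{GF}(q)$. Call a finite graph separating if the product of its clique number $\omega$ (the largest size of a clique) and its coclique number $\alpha$ (the largest size of a set of pairwise non-adjacent vertices) is strictly less than its number of vertices. Then $\mathrm{vLS}(p,e,t)$ is separating if and only if $t$ is even. Moreover, if $t$ is odd, then the subfield $K=\mathrm{GF}(\sqrt q)$ of $\mathrm{GF}(q)$ is a clique of $\mathrm{vLS}(p,e,t)$, for every $\sigma\in\mathrm{GF}(q)$ that is not an $e$-th power the set $K\sigma=\{x\sigma : x\in K\}$ is a coclique, and $\omega\cdot\alpha=q$. -/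

import Mathlib

/-- A finite graph is separating if the product of its clique number and its coclique
(independence) number is strictly less than its number of vertices. -/
def SimpleGraph.IsSeparating {V : Type*} [Finite V] (G : SimpleGraph V) : Prop :=
  G.cliqueNum * G.indepNum < Nat.card V

/-- The van Lint-Schrijver graph with parameters `p`, `e`, `t`: its vertices are the elements of
the field with `p ^ ((e - 1) * t)` elements, and two distinct vertices are adjacent when their
difference is an `e`-th power. Oddness of `e` makes the relation symmetric, since then `-1` is an
`e`-th power. -/
def vanLintSchrijverGraph (p e t : ℕ) [Fact p.Prime] (he : Odd e) :
    SimpleGraph (GaloisField p ((e - 1) * t)) where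
  Adj x y := x ≠ y ∧ ∃ z, x - y = z ^ e
  symm := ⟨fun x y h => ⟨h.1.symm, by
    obtain ⟨z, hz⟩ := h.2
    exact ⟨-z, by rw [he.neg_pow, ← hz, neg_sub]⟩⟩⟩
  loopless := ⟨fun _ h => h.1 rfl⟩

/-! ### Power sums of additive characters, their moments and ratio bounds -/

section PowerCharacterSums

variable {F : Type*} [Field F] [Fintype F]

open Finset

/-! Put r = √q = p ^ ((e - 1) / 2 * t). Since p has order e - 1 modulo e, r ≡ (-1)^t modulo e, and
this sign decides everything.

If t is odd, e is coprime to r - 1, so every element of GF(r) is an e-th power. The subfield K is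
then a clique and Kσ a coclique, both of size r. Differences determine adjacency, so the
clique-coclique bound ω α ≤ q applies and is attained.

If t is even, consider S(z) = ∑ ψ(z x^e) for a Frobenius-invariant ψ. Up to e-th powers, the
non-powers form one Frobenius orbit, so S is constant there, say b, and constant on nonzero powers.
The first two moments of S give b² = q and the value -(e - 1) b on powers (`powerCharSum_values`).
As S ≡ 1 modulo e, b = r (`powerCharSum_eq_of_dvd`). Second-moment estimates bound ω and α by
rationals whose product is exactly q; equality would violate a divisibility
(`mul_lt_sq_of_ratio_bounds`). -/

theorem FiniteField.exists_isPrimitiveRoot_of_dvd {e : ℕ} (he : e ∣ Fintype.card F - 1) :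
    ∃ ζ : F, IsPrimitiveRoot ζ e := by
  obtain ⟨g, hg⟩ := IsCyclic.exists_generator (α := Fˣ)
  have hord : orderOf g = Fintype.card F - 1 := by
    rw [orderOf_eq_card_of_forall_mem_zpowers hg, Nat.card_units,
      Nat.card_eq_fintype_card]
  obtain ⟨k, hk⟩ := he
  have hq : 0 < Fintype.card F - 1 := Nat.sub_pos_of_lt Fintype.one_lt_card
  have h1 : IsPrimitiveRoot (g : F) (Fintype.card F - 1) := by
    rw [← hord]
    exact IsPrimitiveRoot.coe_units_iff.2 (IsPrimitiveRoot.orderOf g)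
  exact ⟨(g : F) ^ k, h1.pow hq (by rw [hk, mul_comm])⟩

/-- The sum of an additive character over the values `z * x ^ e`. -/
noncomputable def powerCharSum (ψ : AddChar F ℂ) (e : ℕ) (z : F) : ℂ := ∑ x, ψ (z * x ^ e)

theorem powerCharSum_zero (ψ : AddChar F ℂ) (e : ℕ) :
    powerCharSum ψ e 0 = Fintype.card F := by
  simp [powerCharSum]

theorem powerCharSum_mul_pow (ψ : AddChar F ℂ) (e : ℕ) (z : F) {s : F} (hs : s ≠ 0) :
    powerCharSum ψ e (z * s ^ e) = powerCharSum ψ e z := by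
  unfold powerCharSum
  refine Fintype.sum_equiv (Equiv.mulLeft₀ s hs) _ _ fun x => ?_
  simp [mul_pow, mul_assoc]

theorem powerCharSum_neg (ψ : AddChar F ℂ) {e : ℕ} (he : Odd e) (z : F) :
    powerCharSum ψ e (-z) = powerCharSum ψ e z := by
  rw [← powerCharSum_mul_pow ψ e z (s := -1) (by simp), he.neg_one_pow, mul_neg_one]

theorem powerCharSum_frobenius (ψ : AddChar F ℂ) (e : ℕ) (p : ℕ) [Fact p.Prime] [CharP F p]
    (hψ : ∀ x, ψ (x ^ p) = ψ x) (z : F) :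
    powerCharSum ψ e (z ^ p) = powerCharSum ψ e z := by
  unfold powerCharSum
  symm
  refine Fintype.sum_equiv (frobeniusEquiv F p).toEquiv _ _ fun x => ?_
  simp only [RingEquiv.toEquiv_eq_coe, EquivLike.coe_coe, frobeniusEquiv_apply, frobenius_def]
  rw [← hψ, mul_pow, ← pow_mul, ← pow_mul, mul_comm e p]

theorem isIntegral_addChar_apply (ψ : AddChar F ℂ) (x : F) : IsIntegral ℤ (ψ x) := by
  refine IsIntegral.of_pow (n := Fintype.card F) Fintype.card_pos ?_
  rw [← AddChar.map_nsmul_eq_pow, card_nsmul_eq_zero, AddChar.map_zero_eq_one]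
  exact isIntegral_one

/-- The power spectrum of a set at a frequency. -/
theorem sum_addChar_mul_sum_neg (ψ : AddChar F ℂ) (Y : Finset F) (c : F) :
    ∑ y ∈ Y, ∑ y' ∈ Y, ψ (c * (y - y')) = ((‖∑ y ∈ Y, ψ (c * y)‖ ^ 2 : ℝ) : ℂ) := by
  push_cast
  rw [← Complex.mul_conj', map_sum, sum_mul_sum]
  refine sum_congr rfl fun y _ => sum_congr rfl fun y' _ => ?_
  rw [← AddChar.map_neg_eq_conj, ← AddChar.map_add_eq_mul]
  congr 1
  ring

theorem norm_sq_sum_addChar_zero {F : Type*} [Field F] (ψ : AddChar F ℂ) (Y : Finset F) :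
    ‖∑ y ∈ Y, ψ (0 * y)‖ ^ 2 = (#Y : ℝ) ^ 2 := by
  simp

variable [DecidableEq F]

theorem FiniteField.card_filter_pow_eq_pow {e : ℕ} (he0 : 0 < e) (he : e ∣ Fintype.card F - 1)
    {x : F} (hx : x ≠ 0) : #{y : F | y ^ e = x ^ e} = e := by
  obtain ⟨ζ, hζ⟩ := FiniteField.exists_isPrimitiveRoot_of_dvd he
  have : ({y : F | y ^ e = x ^ e} : Finset F) =
      (Polynomial.nthRootsFinset e (1 : F)).image (x * ·) := by
    ext y
    simp only [mem_filter, mem_univ, true_and, mem_image, Polynomial.mem_nthRootsFinset he0]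
    constructor
    · intro h
      exact ⟨y / x, by rw [div_pow, h, div_self (pow_ne_zero _ hx)], mul_div_cancel₀ _ hx⟩
    · rintro ⟨u, hu, rfl⟩
      rw [mul_pow, hu, mul_one]
  rw [this, card_image_of_injective _ (mul_right_injective₀ hx), hζ.card_nthRootsFinset]

/-- The nonzero `e`-th powers of a finite field. -/
def nonzeroPowers (F : Type*) [Field F] [Fintype F] [DecidableEq F] (e : ℕ) : Finset F :=
  (univ.erase 0).image (· ^ e)

theorem mem_nonzeroPowers {e : ℕ} {y : F} :
    y ∈ nonzeroPowers F e ↔ ∃ x, x ≠ 0 ∧ x ^ e = y := by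
  simp [nonzeroPowers]

theorem sum_erase_zero_pow {M : Type*} [AddCommMonoid M] {e : ℕ} (he0 : 0 < e)
    (he : e ∣ Fintype.card F - 1) (g : F → M) :
    ∑ x ∈ univ.erase 0, g (x ^ e) = e • ∑ y ∈ nonzeroPowers F e, g y := by
  rw [sum_comp g (· ^ e), smul_sum]
  refine sum_congr rfl fun y hy => ?_
  obtain ⟨x, hx, rfl⟩ := mem_nonzeroPowers.1 hy
  congr 1
  refine Eq.trans (congrArg card ?_) (FiniteField.card_filter_pow_eq_pow he0 he hx)
  ext y
  simp only [mem_filter, mem_erase, mem_univ, and_true, true_and, and_iff_right_iff_imp]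
  rintro h rfl
  exact pow_ne_zero e hx (by rw [← h, zero_pow he0.ne'])

theorem mul_card_nonzeroPowers {e : ℕ} (he0 : 0 < e) (he : e ∣ Fintype.card F - 1) :
    e * #(nonzeroPowers F e) = Fintype.card F - 1 := by
  have := sum_erase_zero_pow (F := F) he0 he (fun _ => (1 : ℕ))
  simpa [card_erase_of_mem, eq_comm] using this

theorem powerCharSum_eq_one_add (ψ : AddChar F ℂ) {e : ℕ} (he0 : 0 < e)
    (he : e ∣ Fintype.card F - 1) (z : F) :
    powerCharSum ψ e z = 1 + e * ∑ y ∈ nonzeroPowers F e, ψ (z * y) := by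
  rw [powerCharSum, ← add_sum_erase _ _ (mem_univ 0),
    sum_erase_zero_pow he0 he (fun y => ψ (z * y))]
  simp [zero_pow he0.ne']

theorem sum_powerCharSum {ψ : AddChar F ℂ} (hψ : ψ.IsPrimitive) {e : ℕ} (he0 : 0 < e) :
    ∑ z, powerCharSum ψ e z = Fintype.card F := by
  simp only [powerCharSum]
  rw [sum_comm]
  simp [AddChar.sum_mulShift _ hψ, he0.ne']

/-- Orthogonality reduces the sum to counting pairs with x^e = y^e: one pair at x = 0 and e for each
nonzero x. For odd e, S(-z) = S(z), so this is the second moment of S. -/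
theorem sum_powerCharSum_mul_neg {ψ : AddChar F ℂ} (hψ : ψ.IsPrimitive) {e : ℕ} (he0 : 0 < e)
    (he : e ∣ Fintype.card F - 1) :
    ∑ z, powerCharSum ψ e z * powerCharSum ψ e (-z) =
      Fintype.card F * (1 + (Fintype.card F - 1) * e) := by
  have h1 : ∀ z, powerCharSum ψ e z * powerCharSum ψ e (-z) =
      ∑ x, ∑ y, ψ (z * (y ^ e - x ^ e)) := by
    intro z
    rw [mul_comm, powerCharSum, powerCharSum, sum_mul_sum]
    refine sum_congr rfl fun x _ => sum_congr rfl fun y _ => ?_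
    rw [← AddChar.map_add_eq_mul]
    congr 1
    ring
  have h2 : ∀ x : F, ∑ y : F, ∑ z, ψ (z * (y ^ e - x ^ e)) =
      Fintype.card F * #{y : F | y ^ e = x ^ e} := by
    intro x
    simp only [AddChar.sum_mulShift _ hψ, sub_eq_zero]
    push_cast
    rw [sum_ite, sum_const, sum_const_zero, add_zero, nsmul_eq_mul, mul_comm]
  simp only [h1]
  rw [sum_comm]
  have h3 : ∀ x : F, ∑ z, ∑ y, ψ (z * (y ^ e - x ^ e)) =
      Fintype.card F * #{y : F | y ^ e = x ^ e} := fun x => by rw [sum_comm, h2]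
  simp only [h3]
  rw [← mul_sum, ← add_sum_erase _ _ (mem_univ 0),
    sum_congr rfl fun x hx => by
      rw [FiniteField.card_filter_pow_eq_pow he0 he (ne_of_mem_erase hx)]]
  have h0 : ({y : F | y ^ e = 0 ^ e} : Finset F) = {0} := by
    ext y
    simp [he0.ne']
  rw [h0, sum_const, card_erase_of_mem (mem_univ _), card_univ, nsmul_eq_mul,
    Nat.cast_sub Fintype.card_pos]
  simp

theorem sum_eq_of_eq_on_nonzeroPowers {e : ℕ} (he0 : 0 < e) (he : e ∣ Fintype.card F - 1)
    {f : F → ℂ} {a b : ℂ} (ha : ∀ z ∈ nonzeroPowers F e, f z = a)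
    (hb : ∀ z, z ≠ 0 → z ∉ nonzeroPowers F e → f z = b) :
    e * ∑ z, f z = e * f 0 + (Fintype.card F - 1) * (a + (e - 1) * b) := by
  have hsub : nonzeroPowers F e ⊆ univ.erase 0 := by
    intro y hy
    obtain ⟨x, hx, rfl⟩ := mem_nonzeroPowers.1 hy
    simp [hx]
  have hk := mul_card_nonzeroPowers (F := F) he0 he
  have hk' : (e : ℂ) * #(nonzeroPowers F e) = Fintype.card F - 1 := by
    rw [← Nat.cast_mul, hk, Nat.cast_sub Fintype.card_pos, Nat.cast_one]
  rw [← add_sum_erase _ _ (mem_univ 0), ← sum_sdiff hsub, sum_congr rfl ha,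
    sum_congr rfl fun z hz => hb z (ne_of_mem_erase (mem_sdiff.1 hz).1) (mem_sdiff.1 hz).2,
    sum_const, sum_const, card_sdiff_of_subset hsub, card_erase_of_mem (mem_univ _), card_univ,
    nsmul_eq_mul, nsmul_eq_mul, Nat.cast_sub (hk ▸ Nat.le_mul_of_pos_left _ he0),
    Nat.cast_sub Fintype.card_pos, ← hk']
  push_cast
  linear_combination (-e * b) * hk'

theorem powerCharSum_values {ψ : AddChar F ℂ} (hψ : ψ.IsPrimitive) {e : ℕ} (he1 : 1 < e)
    (hodd : Odd e) (he : e ∣ Fintype.card F - 1) {b : ℂ}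
    (hb : ∀ z, z ≠ 0 → z ∉ nonzeroPowers F e → powerCharSum ψ e z = b) :
    b ^ 2 = Fintype.card F ∧ ∀ z ∈ nonzeroPowers F e, powerCharSum ψ e z = -(e - 1) * b := by
  have he0 : 0 < e := by lia
  have ha : ∀ z ∈ nonzeroPowers F e, powerCharSum ψ e z = powerCharSum ψ e 1 := by
    intro z hz
    obtain ⟨x, hx, rfl⟩ := mem_nonzeroPowers.1 hz
    rw [← powerCharSum_mul_pow ψ e 1 hx, one_mul]
  have hq : (Fintype.card F : ℂ) - 1 ≠ 0 := by
    rw [sub_ne_zero]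
    exact_mod_cast (Fintype.one_lt_card (α := F)).ne'
  have hec : (e : ℂ) ≠ 0 := by exact_mod_cast he0.ne'
  have hec1 : (e : ℂ) - 1 ≠ 0 := by
    rw [sub_ne_zero]
    exact_mod_cast he1.ne'
  have h1 := sum_eq_of_eq_on_nonzeroPowers he0 he ha hb
  rw [sum_powerCharSum hψ he0, powerCharSum_zero, left_eq_add, mul_eq_zero, or_iff_right hq] at h1
  have h2 := sum_eq_of_eq_on_nonzeroPowers he0 he (f := fun z => powerCharSum ψ e z ^ 2)
    (a := powerCharSum ψ e 1 ^ 2) (b := b ^ 2)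
    (fun z hz => by simp only [ha z hz]) (fun z hz hz' => by simp only [hb z hz hz'])
  have h3 := sum_powerCharSum_mul_neg hψ he0 he
  simp only [powerCharSum_neg ψ hodd, ← sq] at h3
  rw [h3, powerCharSum_zero, eq_neg_of_add_eq_zero_left h1] at h2
  constructor
  -- Substituting a = -(e - 1) b from the first moment into the second leaves only b² - q, up to
  -- nonzero factors.
  · have : ((Fintype.card F : ℂ) - 1) * (e * (e - 1)) * (b ^ 2 - Fintype.card F) = 0 := by
      linear_combination -h2
    simpa [hq, hec, hec1, sub_eq_zero] using this
  · intro z hz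
    rw [ha z hz]
    linear_combination h1

/-- The sign of the square root is determined by a congruence modulo `e`. -/
theorem powerCharSum_eq_of_dvd (ψ : AddChar F ℂ) {e r : ℕ} (he1 : 1 < e) (hodd : Odd e)
    (he : e ∣ Fintype.card F - 1) (hr : e ∣ r - 1) (hr0 : 0 < r) {z : F}
    (hz : powerCharSum ψ e z ^ 2 = (r : ℂ) ^ 2) : powerCharSum ψ e z = r := by
  have he0 : 0 < e := by lia
  rcases sq_eq_sq_iff_eq_or_eq_neg.1 hz with h | h
  · exact h
  · exfalso
    -- If S(z) = 1 + e s were -r, then s = -(r + 1)/e would be a rational algebraic integer, so e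
    -- would divide r + 1 as well as r - 1, hence 2.
    set s := ∑ y ∈ nonzeroPowers F e, ψ (z * y) with hs
    have hint : IsIntegral ℤ s := IsIntegral.sum _ fun y _ => isIntegral_addChar_apply ψ _
    rw [powerCharSum_eq_one_add ψ he0 he, ← hs] at h
    have hec : (e : ℂ) ≠ 0 := by exact_mod_cast he0.ne'
    have hsq : s = algebraMap ℚ ℂ (-(r + 1) / e) := by
      rw [eq_ratCast]
      push_cast
      field_simp
      linear_combination h
    rw [hsq, isIntegral_algebraMap_iff (algebraMap ℚ ℂ).injective] at hint
    obtain ⟨m, hm⟩ := IsIntegrallyClosed.isIntegral_iff.1 hint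
    have heq : (e : ℚ) ≠ 0 := by exact_mod_cast he0.ne'
    rw [eq_intCast, eq_div_iff heq] at hm
    have hm' : m * e = -(r + 1) := by exact_mod_cast hm
    have h1 : (e : ℤ) ∣ r + 1 := ⟨-m, by linear_combination hm'⟩
    have h2 : (e : ℤ) ∣ r - 1 := by
      have := Int.natCast_dvd_natCast.2 hr
      rwa [Nat.cast_sub hr0, Nat.cast_one] at this
    have h3 : (e : ℤ) ∣ 2 := by
      have := dvd_sub h1 h2
      ring_nf at this
      exact this
    have h4 : e ∣ 2 := by exact_mod_cast h3
    have h5 := Nat.le_of_dvd two_pos h4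
    obtain ⟨c, hc⟩ := hodd
    lia

theorem sum_norm_sq_eq_of_powerCharSum_sub (ψ : AddChar F ℂ) (e : ℕ) {Y : Finset F} {a : ℝ}
    (hY : ∀ y ∈ Y, ∀ y' ∈ Y, y ≠ y' → powerCharSum ψ e (y - y') = a) :
    ∑ x : F, ‖∑ y ∈ Y, ψ (x ^ e * y)‖ ^ 2 =
      (#Y : ℝ) * (Fintype.card F + (#Y - 1) * a) := by
  have : ((∑ x : F, ‖∑ y ∈ Y, ψ (x ^ e * y)‖ ^ 2 : ℝ) : ℂ) =
      ((#Y : ℝ) * (Fintype.card F + (#Y - 1) * a) : ℝ) := by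
    rw [Complex.ofReal_sum]
    simp only [← sum_addChar_mul_sum_neg]
    rw [sum_comm]
    have h : ∀ y ∈ Y, ∑ x : F, ∑ y' ∈ Y, ψ (x ^ e * (y - y')) =
        Fintype.card F + (#Y - 1) * (a : ℂ) := by
      intro y hy
      rw [sum_comm]
      have h1 : ∀ y', ∑ x : F, ψ (x ^ e * (y - y')) = powerCharSum ψ e (y - y') := fun y' => by
        simp only [powerCharSum, mul_comm]
      simp only [h1]
      rw [← add_sum_erase _ _ hy, sub_self, powerCharSum_zero,
        sum_congr rfl fun y' hy' =>
          hY y hy y' (mem_of_mem_erase hy') (ne_of_mem_erase hy').symm,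
        sum_const, card_erase_of_mem hy, nsmul_eq_mul, Nat.cast_sub (card_pos.2 ⟨y, hy⟩),
        Nat.cast_one]
    rw [sum_congr rfl h, sum_const, nsmul_eq_mul]
    push_cast
    rfl
  exact_mod_cast this

/-- Parseval, obtained as the case e = 1: there the power sums vanish off zero by orthogonality. -/
theorem sum_norm_sq_addChar {ψ : AddChar F ℂ} (hψ : ψ.IsPrimitive) (Y : Finset F) :
    ∑ c : F, ‖∑ y ∈ Y, ψ (c * y)‖ ^ 2 = (Fintype.card F : ℝ) * #Y := by
  have h0 : ∀ z : F, z ≠ 0 → powerCharSum ψ 1 z = (0 : ℝ) := by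
    intro z hz
    simp only [powerCharSum, pow_one, mul_comm z]
    rw [AddChar.sum_mulShift _ hψ, if_neg hz]
    simp
  have := sum_norm_sq_eq_of_powerCharSum_sub ψ 1 (Y := Y) (a := 0)
    fun y _ y' _ h => h0 _ (sub_ne_zero.2 h)
  simpa [mul_comm] using this

/-- Upper bound for a set whose differences have constant negative power sums. -/
theorem card_mul_le_of_powerCharSum_eq (ψ : AddChar F ℂ) {e : ℕ} (he0 : 0 < e) {Y : Finset F}
    {a : ℝ} (hY : ∀ y ∈ Y, ∀ y' ∈ Y, y ≠ y' → powerCharSum ψ e (y - y') = a) (hne : Y.Nonempty) :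
    (#Y : ℝ) * (1 - a) ≤ Fintype.card F - a := by
  have h1 := sum_norm_sq_eq_of_powerCharSum_sub ψ e hY
  -- Only the term x = 0 of a sum of squares is kept.
  have h2 : (#Y : ℝ) ^ 2 ≤ ∑ x : F, ‖∑ y ∈ Y, ψ (x ^ e * y)‖ ^ 2 := by
    have := single_le_sum (f := fun x : F => ‖∑ y ∈ Y, ψ (x ^ e * y)‖ ^ 2)
      (fun x _ => sq_nonneg _) (mem_univ 0)
    simpa only [zero_pow he0.ne', norm_sq_sum_addChar_zero] using this
  rw [h1, sq] at h2
  have := le_of_mul_le_mul_left h2 (by exact_mod_cast card_pos.2 hne)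
  linarith

/-- Upper bound for a set whose differences have constant positive power sums. -/
theorem card_mul_le_of_powerCharSum_eq_of_isPrimitive {ψ : AddChar F ℂ} (hψ : ψ.IsPrimitive)
    {e : ℕ} (he0 : 0 < e) (he : e ∣ Fintype.card F - 1) {Y : Finset F} {b : ℝ}
    (hY : ∀ y ∈ Y, ∀ y' ∈ Y, y ≠ y' → powerCharSum ψ e (y - y') = b) (hne : Y.Nonempty) :
    (#Y : ℝ) * (b + e - 1) ≤ (e - 1) * Fintype.card F + b := by
  have h1 := sum_norm_sq_eq_of_powerCharSum_sub ψ e hY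
  have h3 := sum_norm_sq_addChar hψ Y
  rw [← add_sum_erase _ _ (mem_univ 0), zero_pow he0.ne', norm_sq_sum_addChar_zero,
    sum_erase_zero_pow he0 he (fun c => ‖∑ y ∈ Y, ψ (c * y)‖ ^ 2), nsmul_eq_mul] at h1
  rw [← add_sum_erase _ _ (mem_univ 0), norm_sq_sum_addChar_zero] at h3
  -- The frequencies that are e-th powers carry at most the whole nonzero spectrum, which Parseval
  -- evaluates.
  have h2 : ∑ c ∈ nonzeroPowers F e, ‖∑ y ∈ Y, ψ (c * y)‖ ^ 2 ≤
      ∑ c ∈ univ.erase 0, ‖∑ y ∈ Y, ψ (c * y)‖ ^ 2 := by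
    refine sum_le_sum_of_subset_of_nonneg ?_ fun _ _ _ => sq_nonneg _
    intro y hy
    obtain ⟨x, hx, rfl⟩ := mem_nonzeroPowers.1 hy
    simp [hx]
  have h4 := mul_le_mul_of_nonneg_left h2 (Nat.cast_nonneg (α := ℝ) e)
  have hpos : (0 : ℝ) < #Y := by exact_mod_cast card_pos.2 hne
  have h5 : (#Y : ℝ) * (#Y * (b + e - 1)) ≤ #Y * ((e - 1) * Fintype.card F + b) := by
    nlinarith
  exact le_of_mul_le_mul_left h5 hpos

end PowerCharacterSums

/-! ### Frobenius invariance and cosets of the e-th powers -/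

theorem exists_isPrimitive_addChar_pow_invariant (F : Type*) [Field F] [Finite F] (p : ℕ)
    [Fact p.Prime] [Algebra (ZMod p) F] :
    ∃ ψ : AddChar F ℂ, ψ.IsPrimitive ∧ ∀ x, ψ (x ^ p) = ψ x := by
  have : CharP F p := charP_of_injective_algebraMap' (ZMod p) p
  -- The trace to the prime field is Frobenius-invariant and surjective, hence so invariant and
  -- nontrivial is its composite with the standard character.
  let ψ : AddChar F ℂ :=
    (ZMod.stdAddChar (N := p)).compAddMonoidHom (Algebra.trace (ZMod p) F).toAddMonoidHom
  refine ⟨ψ, AddChar.IsPrimitive.of_ne_one ?_, fun x => ?_⟩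
  · obtain ⟨b, hb⟩ : ∃ b : F, Algebra.trace (ZMod p) F b ≠ 0 := by
      obtain ⟨b, hb⟩ := Algebra.trace_surjective (ZMod p) F 1
      exact ⟨b, by rw [hb]; exact one_ne_zero⟩
    intro h
    refine hb (ZMod.injective_stdAddChar ?_)
    rw [AddChar.map_zero_eq_one]
    exact DFunLike.congr_fun h b
  · have h := Algebra.trace_eq_of_algEquiv
      (FiniteField.frobeniusAlgEquivOfAlgebraic (ZMod p) F) x
    rw [FiniteField.coe_frobeniusAlgEquivOfAlgebraic, ZMod.card] at h
    exact congrArg ZMod.stdAddChar h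

/-- Every residue prime to `e` is a power of a primitive root. -/
theorem exists_pow_eq_of_orderOf_eq {e p : ℕ} [Fact e.Prime]
    (hp : orderOf (p : ZMod e) = e - 1) {u : ZMod e} (hu : u ≠ 0) :
    ∃ i : ℕ, (p : ZMod e) ^ i = u := by
  have hp0 : (p : ZMod e) ≠ 0 := by
    intro h
    have h2 := (Fact.out : e.Prime).two_le
    rw [h, orderOf_zero] at hp
    lia
  have hord : orderOf (Units.mk0 _ hp0) = Nat.card (ZMod e)ˣ := by
    rw [Nat.card_eq_fintype_card, ZMod.card_units, ← hp, ← orderOf_units, Units.val_mk0]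
  have htop : Subgroup.zpowers (Units.mk0 _ hp0) = ⊤ :=
    Subgroup.eq_top_of_card_eq _ (by rw [Nat.card_zpowers, hord])
  obtain ⟨i, hi⟩ := mem_powers_iff_mem_zpowers.2
    (htop ▸ Subgroup.mem_top (Units.mk0 u hu) :
      Units.mk0 u hu ∈ Subgroup.zpowers (Units.mk0 _ hp0))
  exact ⟨i, by simpa using congrArg Units.val hi⟩

/-- Up to nonzero `e`-th powers, all non-powers are conjugate under the Frobenius map. -/
theorem exists_pow_mul_pow_eq_of_not_pow {F : Type*} [Field F] [Finite F] {e p : ℕ}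
    [Fact e.Prime] (hp : orderOf (p : ZMod e) = e - 1) {w z : F}
    (hw : ¬ ∃ x, x ^ e = w) (hz : ¬ ∃ x, x ^ e = z) :
    ∃ (i : ℕ) (s : F), s ≠ 0 ∧ z = w ^ p ^ i * s ^ e := by
  have he0 : e ≠ 0 := (Fact.out : e.Prime).ne_zero
  have hw0 : w ≠ 0 := fun h => hw ⟨0, by rw [h, zero_pow he0]⟩
  have hz0 : z ≠ 0 := fun h => hz ⟨0, by rw [h, zero_pow he0]⟩
  obtain ⟨g, hg⟩ := IsCyclic.exists_generator (α := Fˣ)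
  obtain ⟨m, hm⟩ := hg (Units.mk0 w hw0)
  obtain ⟨n, hn⟩ := hg (Units.mk0 z hz0)
  have key : ∀ (k : ℤ) (y : F) (hy0 : y ≠ 0), g ^ k = Units.mk0 y hy0 → (¬ ∃ x, x ^ e = y) →
      (k : ZMod e) ≠ 0 := by
    intro k y hy0 hk hy h
    obtain ⟨c, rfl⟩ := (ZMod.intCast_zmod_eq_zero_iff_dvd k e).1 h
    refine hy ⟨((g ^ c : Fˣ) : F), ?_⟩
    rw [← Units.val_pow_eq_pow_val, ← zpow_natCast, ← zpow_mul, mul_comm, hk, Units.val_mk0]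
  have hm0 := key m w hw0 hm hw
  have hn0 := key n z hz0 hn hz
  -- With w = g^m and z = g^n, the exponent i solves m p^i ≡ n modulo e; the remaining multiple of e
  -- in the exponent becomes s^e.
  obtain ⟨i, hi⟩ := exists_pow_eq_of_orderOf_eq hp (div_ne_zero hn0 hm0)
  have hdvd : (e : ℤ) ∣ n - m * p ^ i := by
    rw [← ZMod.intCast_zmod_eq_zero_iff_dvd]
    push_cast
    rw [hi, mul_div_cancel₀ _ hm0, sub_self]
  obtain ⟨c, hc⟩ := hdvd
  refine ⟨i, ((g ^ c : Fˣ) : F), Units.ne_zero _, ?_⟩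
  have h1 : Units.mk0 z hz0 = Units.mk0 w hw0 ^ p ^ i * (g ^ c) ^ e := by
    rw [← hm, ← hn, ← zpow_natCast, ← zpow_mul, ← zpow_natCast, ← zpow_mul, ← zpow_add]
    congr 1
    push_cast
    linear_combination hc
  simpa using congrArg Units.val h1

theorem powerCharSum_pow_eq {F : Type*} [Field F] [Fintype F] (ψ : AddChar F ℂ) {e p : ℕ}
    [Fact p.Prime] [CharP F p] (hψ : ∀ x, ψ (x ^ p) = ψ x) (z : F) (i : ℕ) :
    powerCharSum ψ e (z ^ p ^ i) = powerCharSum ψ e z := by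
  induction i with
  | zero => simp
  | succ i ih => rw [pow_succ, pow_mul, powerCharSum_frobenius ψ e p hψ, ih]

theorem powerCharSum_eq_of_not_pow {F : Type*} [Field F] [Fintype F] (ψ : AddChar F ℂ)
    {e p : ℕ} [Fact p.Prime] [CharP F p] [Fact e.Prime] (hp : orderOf (p : ZMod e) = e - 1)
    (hψ : ∀ x, ψ (x ^ p) = ψ x) {w z : F} (hw : ¬ ∃ x, x ^ e = w) (hz : ¬ ∃ x, x ^ e = z) :
    powerCharSum ψ e z = powerCharSum ψ e w := by
  obtain ⟨i, s, hs, rfl⟩ := exists_pow_mul_pow_eq_of_not_pow hp hw hz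
  rw [powerCharSum_mul_pow ψ e _ hs, powerCharSum_pow_eq ψ hψ]

theorem exists_not_pow {F : Type*} [Field F] [Finite F] {e : ℕ} (he1 : 1 < e)
    (he : e ∣ Nat.card F - 1) : ∃ σ : F, ¬ ∃ x, x ^ e = σ := by
  have := Fintype.ofFinite F
  rw [Nat.card_eq_fintype_card] at he
  by_contra! h
  obtain ⟨ζ, hζ⟩ := FiniteField.exists_isPrimitiveRoot_of_dvd he
  have hinj : Function.Injective (fun x : F => x ^ e) :=
    Finite.injective_iff_surjective.2 h
  refine hζ.ne_one he1 (hinj ?_)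
  simp [hζ.pow_eq_one]

/-- A primitive root modulo an odd prime has the half-order power `-1`. -/
theorem pow_half_eq_neg_one {e p : ℕ} [Fact e.Prime] (hodd : Odd e)
    (hp : orderOf (p : ZMod e) = e - 1) : (p : ZMod e) ^ ((e - 1) / 2) = -1 := by
  have h2 := (Fact.out : e.Prime).two_le
  obtain ⟨c, hc⟩ := hodd
  have h : ((p : ZMod e) ^ ((e - 1) / 2)) ^ 2 = 1 := by
    rw [← pow_mul, show (e - 1) / 2 * 2 = e - 1 by lia, ← hp, pow_orderOf_eq_one]
  refine (mul_self_eq_one_iff.1 (by rwa [← sq])).resolve_left ?_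
  intro h1
  have := orderOf_le_of_pow_eq_one (by lia) h1
  lia

/-! ### The clique-coclique bound and the exclusion of equality -/

namespace SimpleGraph

/-- The clique-coclique bound for graphs whose adjacency depends on differences only. -/
theorem cliqueNum_mul_indepNum_le_of_sub {V : Type*} [AddCommGroup V] [Finite V]
    (G : SimpleGraph V) (hG : ∀ a b c d : V, a - b = c - d → G.Adj a b → G.Adj c d) :
    G.cliqueNum * G.indepNum ≤ Nat.card V := by
  obtain ⟨C, hC⟩ := G.exists_isNClique_cliqueNum
  obtain ⟨D, hD⟩ := G.exists_isNIndepSet_indepNum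
  rw [← hC.card_eq, ← hD.card_eq, ← Finset.card_product, ← Set.ncard_coe_finset,
    ← Set.ncard_univ]
  -- Addition is injective on C × D: a collision gives c - c' = d' - d, and if this is nonzero the
  -- adjacency of c, c' passes to d', d.
  refine Set.ncard_le_ncard_of_injOn (fun x => x.1 + x.2) (fun _ _ => Set.mem_univ _) ?_
    Set.finite_univ
  rintro ⟨c, d⟩ h ⟨c', d'⟩ h' heq
  simp only [Finset.coe_product, Set.mem_prod, SetLike.mem_coe] at h h' heq
  have hcd : c - c' = d' - d := by
    rw [sub_eq_sub_iff_add_eq_add, heq, add_comm]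
  by_cases hc : c = c'
  · subst hc
    rw [sub_self, eq_comm, sub_eq_zero] at hcd
    rw [hcd]
  · exfalso
    have hd : d' ≠ d := by
      rintro rfl
      exact hc (sub_eq_zero.1 (by rw [hcd, sub_self]))
    exact hD.isIndepSet h'.2 h.2 hd (hG _ _ _ _ hcd (hC.isClique h.1 h'.1 hc))

end SimpleGraph

/-- An equality case of the two ratio bounds would force an impossible divisibility. -/
theorem mul_lt_sq_of_ratio_bounds {e r w a : ℕ} (he : 2 < e) (hr : 1 < r)
    (hw : w * ((e - 1) * r + 1) ≤ r * (r + (e - 1)))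
    (ha : a * (r + (e - 1)) ≤ r * ((e - 1) * r + 1)) : w * a < r ^ 2 := by
  obtain ⟨f, rfl⟩ : ∃ f, e = f + 1 := ⟨e - 1, by lia⟩
  simp only [Nat.add_sub_cancel] at hw ha
  by_contra! h
  have hpos : 0 < f * r + 1 := by positivity
  have hN : 0 < r + f := by positivity
  have heq : w * (f * r + 1) = r * (r + f) := by
    refine le_antisymm hw ?_
    by_contra! hlt
    have ha0 : 0 < a * (r + f) := by
      refine Nat.mul_pos (Nat.pos_of_ne_zero ?_) hN
      rintro rfl
      simp at h
      lia
    have h1 : (w * (f * r + 1)) * (a * (r + f)) < (r * (r + f)) * (r * (f * r + 1)) :=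
      lt_of_lt_of_le (Nat.mul_lt_mul_of_pos_right hlt ha0) (Nat.mul_le_mul_left _ ha)
    have h2 := Nat.mul_le_mul_right ((f * r + 1) * (r + f)) h
    refine absurd h1 (not_lt.2 ?_)
    calc _ = r ^ 2 * ((f * r + 1) * (r + f)) := by ring
      _ ≤ _ := h2
      _ = _ := by ring
  -- Equality gives f r + 1 ∣ r (r + f), hence f r + 1 ∣ r + f by coprimality; but f r + 1 exceeds r
  -- + f by (f - 1)(r - 1) > 0.
  have hcop : Nat.Coprime (f * r + 1) r := by simp
  have hdvd : f * r + 1 ∣ r + f := hcop.dvd_of_dvd_mul_left ⟨w, by rw [← heq, mul_comm]⟩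
  have hle := Nat.le_of_dvd hN hdvd
  nlinarith

/-! ### The two parities of t for the van Lint–Schrijver graph -/

section vanLintSchrijver

variable {p e t : ℕ} [Fact p.Prime]

theorem vanLintSchrijverGraph_adj (he : Odd e) {x y : GaloisField p ((e - 1) * t)} :
    (vanLintSchrijverGraph p e t he).Adj x y ↔ x ≠ y ∧ ∃ z, x - y = z ^ e := Iff.rfl

theorem vanLintSchrijverGraph_cliqueNum_mul_indepNum_le (he : Odd e) :
    (vanLintSchrijverGraph p e t he).cliqueNum * (vanLintSchrijverGraph p e t he).indepNum ≤
      Nat.card (GaloisField p ((e - 1) * t)) := by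
  refine SimpleGraph.cliqueNum_mul_indepNum_le_of_sub _ fun a b c d h hab => ?_
  rw [vanLintSchrijverGraph_adj, ← sub_ne_zero, h] at hab
  rwa [vanLintSchrijverGraph_adj, ← sub_ne_zero]

/-- The subfield of order `√q` is a clique, and its multiples by non-powers are cocliques. -/
theorem exists_subfield_isClique_isIndepSet (he : e.Prime) (hodd : Odd e)
    (hp : orderOf (p : ZMod e) = e - 1) (ht : Odd t) :
    ∃ K : Subfield (GaloisField p ((e - 1) * t)),
      Nat.card K ^ 2 = p ^ ((e - 1) * t) ∧
      (vanLintSchrijverGraph p e t hodd).IsClique (K : Set (GaloisField p ((e - 1) * t))) ∧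
      ∀ σ : GaloisField p ((e - 1) * t), (¬ ∃ z, σ = z ^ e) →
        (vanLintSchrijverGraph p e t hodd).IsIndepSet ((fun x => x * σ) '' (K : Set _)) := by
  have : Fact e.Prime := ⟨he⟩
  have he2 := he.two_le
  have hhalf : (e - 1) / 2 * 2 = e - 1 := by
    obtain ⟨c, hc⟩ := hodd
    lia
  have ht0 : 0 < t := ht.pos
  set m := (e - 1) / 2 * t with hm
  have hmn : m * 2 = (e - 1) * t := by rw [hm, mul_right_comm, hhalf]
  have hn0 : (e - 1) * t ≠ 0 := (Nat.mul_pos (by lia) ht0).ne'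
  have hm0 : m ≠ 0 := by lia
  obtain ⟨f⟩ := FiniteField.nonempty_algHom_of_finrank_dvd
    (F := ZMod p) (K := GaloisField p m) (L := GaloisField p ((e - 1) * t)) (by
      rw [GaloisField.finrank p hm0, GaloisField.finrank p hn0]
      exact ⟨2, hmn.symm⟩)
  -- For odd t, p^m ≡ -1 modulo e, so p^m - 1 ≡ -2, which is nonzero because e is odd.
  have hcop : Nat.Coprime e (p ^ m - 1) := by
    rw [he.coprime_iff_not_dvd, ← ZMod.natCast_eq_zero_iff,
      Nat.cast_sub (Nat.one_le_pow _ _ (Fact.out : p.Prime).pos), Nat.cast_pow, hm, pow_mul,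
      pow_half_eq_neg_one hodd hp, ht.neg_one_pow]
    intro h
    have h2 : ((2 : ℕ) : ZMod e) = 0 := by
      push_cast
      linear_combination -h
    have := Nat.le_of_dvd two_pos ((ZMod.natCast_eq_zero_iff 2 e).1 h2)
    obtain ⟨c, hc⟩ := hodd
    lia
  have hpow : ∀ x : GaloisField p m, ∃ y, x = y ^ e := by
    intro x
    by_cases hx : x = 0
    · exact ⟨0, by rw [hx, zero_pow he.ne_zero]⟩
    · have hx1 : x ^ (p ^ m - 1) = 1 := by
        have := Fintype.ofFinite (GaloisField p m)
        rw [← GaloisField.card p m hm0, Nat.card_eq_fintype_card]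
        exact FiniteField.pow_card_sub_one_eq_one x hx
      obtain ⟨k, hk⟩ := exists_pow_eq_self_of_coprime
        (hcop.coprime_dvd_right (orderOf_dvd_of_pow_eq_one hx1))
      exact ⟨x ^ k, by rw [pow_right_comm, hk]⟩
  refine ⟨f.toRingHom.fieldRange, ?_, ?_, ?_⟩
  · have h : Nat.card f.toRingHom.fieldRange = p ^ m := by
      rw [← GaloisField.card p m hm0]
      exact Nat.card_congr (Equiv.ofInjective f f.toRingHom.injective).symm
    rw [h, ← pow_mul, hmn]
  · rintro _ ⟨x, rfl⟩ _ ⟨y, rfl⟩ hxy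
    obtain ⟨z, hz⟩ := hpow (x - y)
    refine ⟨hxy, f z, ?_⟩
    rw [← map_pow, ← hz, map_sub]
    rfl
  · rintro σ hσ _ ⟨_, ⟨x, rfl⟩, rfl⟩ _ ⟨_, ⟨y, rfl⟩, rfl⟩ hne ⟨-, w, hw⟩
    obtain ⟨z, hz⟩ := hpow (x - y)
    have hfz : f.toRingHom x - f.toRingHom y = f z ^ e := by
      rw [← map_pow, ← hz, map_sub]
      rfl
    have hz0 : f z ^ e ≠ 0 := by
      rw [← hfz, sub_ne_zero]
      rintro h
      exact hne (by simp only [h])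
    -- The difference (x - y) σ is w^e while x - y is itself the nonzero power (f z)^e, so σ would
    -- be an e-th power.
    refine hσ ⟨w / f z, ?_⟩
    rw [div_pow, eq_div_iff hz0, ← hw, ← hfz]
    ring

open Finset in
theorem vanLintSchrijverGraph_cliqueNum_mul_indepNum_lt (he : e.Prime) (hodd : Odd e)
    (hp : orderOf (p : ZMod e) = e - 1) (ht : Even t) (ht0 : 0 < t) :
    (vanLintSchrijverGraph p e t hodd).cliqueNum * (vanLintSchrijverGraph p e t hodd).indepNum <
      p ^ ((e - 1) * t) := by
  classical
  have : Fact e.Prime := ⟨he⟩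
  have he2 : 2 < e := by
    have := he.two_le
    obtain ⟨c, hc⟩ := hodd
    lia
  have hhalf : (e - 1) / 2 * 2 = e - 1 := by
    obtain ⟨c, hc⟩ := hodd
    lia
  set n := (e - 1) * t with hn
  set r := p ^ ((e - 1) / 2 * t) with hr
  have hrn : r ^ 2 = p ^ n := by rw [hr, ← pow_mul, mul_right_comm, hhalf]
  have hn0 : n ≠ 0 := (Nat.mul_pos (by lia) ht0).ne'
  have hr1 : 1 < r := Nat.one_lt_pow
    (Nat.mul_pos (by lia) ht0).ne' (Fact.out : p.Prime).one_lt
  have hre : (r : ZMod e) = 1 := by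
    rw [hr, Nat.cast_pow, pow_mul, pow_half_eq_neg_one hodd hp, ht.neg_one_pow]
  have hdvd : e ∣ r - 1 := by
    rw [← ZMod.natCast_eq_zero_iff, Nat.cast_sub hr1.le, hre, Nat.cast_one, sub_self]
  let F := GaloisField p n
  have : Fintype F := Fintype.ofFinite F
  have hcard : Fintype.card F = r ^ 2 := by
    rw [← Nat.card_eq_fintype_card, hrn, GaloisField.card p n hn0]
  have hq : e ∣ Fintype.card F - 1 := by
    rw [hcard]
    exact hdvd.trans (by simpa using Nat.sub_dvd_pow_sub_pow r 1 2)
  obtain ⟨ψ, hψ, hfrob⟩ := exists_isPrimitive_addChar_pow_invariant F p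
  obtain ⟨σ, hσ⟩ := exists_not_pow (F := F) he.one_lt (by rwa [Nat.card_eq_fintype_card])
  have hconst : ∀ z : F, (¬ ∃ x, x ^ e = z) → powerCharSum ψ e z = powerCharSum ψ e σ :=
    fun z hz => powerCharSum_eq_of_not_pow ψ hp hfrob hσ hz
  obtain ⟨hsq, hval⟩ := powerCharSum_values hψ he.one_lt hodd hq (b := powerCharSum ψ e σ) (by
    intro z hz0 hz
    refine hconst z ?_
    rintro ⟨x, rfl⟩
    exact hz (mem_nonzeroPowers.2 ⟨x, fun h => hz0 (by rw [h, zero_pow he.ne_zero]), rfl⟩))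
  have hσr : powerCharSum ψ e σ = r := powerCharSum_eq_of_dvd ψ he.one_lt hodd hq hdvd
    (by lia) (by rw [hsq, hcard, Nat.cast_pow])
  obtain ⟨C, hC⟩ := (vanLintSchrijverGraph p e t hodd).exists_isNClique_cliqueNum
  obtain ⟨D, hD⟩ := (vanLintSchrijverGraph p e t hodd).exists_isNIndepSet_indepNum
  rw [← hrn, ← hC.card_eq, ← hD.card_eq]
  have he1 : ((e - 1 : ℕ) : ℝ) = e - 1 := by rw [Nat.cast_sub he.one_le, Nat.cast_one]
  -- Differences in C have power sum -(e - 1) r and those in D have r; each constant is fed to its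
  -- own ratio bound with q = r².
  apply mul_lt_sq_of_ratio_bounds he2 hr1
  · rcases C.eq_empty_or_nonempty with rfl | hne
    · simp
    have h := card_mul_le_of_powerCharSum_eq ψ he.pos (Y := C) (a := -(e - 1) * r) (by
      intro y hy y' hy' hyy
      obtain ⟨-, z, hz⟩ := hC.isClique hy hy' hyy
      have hz0 : z ≠ 0 := by
        rintro rfl
        rw [zero_pow he.ne_zero, sub_eq_zero] at hz
        exact hyy hz
      rw [hval _ (mem_nonzeroPowers.2 ⟨z, hz0, hz.symm⟩), hσr]
      push_cast
      rfl) hne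
    rw [hcard] at h
    push_cast at h
    rify
    rw [he1]
    linarith
  · rcases D.eq_empty_or_nonempty with rfl | hne
    · simp
    have h := card_mul_le_of_powerCharSum_eq_of_isPrimitive hψ he.pos hq (Y := D) (b := r) (by
      intro y hy y' hy' hyy
      rw [hconst, hσr, Complex.ofReal_natCast]
      rintro ⟨z, hz⟩
      exact hD.isIndepSet hy hy' hyy ⟨hyy, z, hz.symm⟩) hne
    rw [hcard] at h
    push_cast at h
    rify
    rw [he1]
    linarith

theorem vanLintSchrijverGraph_cliqueNum_mul_indepNum_eq (he : e.Prime) (hodd : Odd e)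
    (hp : orderOf (p : ZMod e) = e - 1) (ht : Odd t) :
    (vanLintSchrijverGraph p e t hodd).cliqueNum * (vanLintSchrijverGraph p e t hodd).indepNum =
      p ^ ((e - 1) * t) := by
  classical
  have : Fact e.Prime := ⟨he⟩
  have hn0 : (e - 1) * t ≠ 0 := (Nat.mul_pos (Nat.sub_pos_of_lt he.one_lt) ht.pos).ne'
  have := Fintype.ofFinite (GaloisField p ((e - 1) * t))
  have hcard := GaloisField.card p _ hn0
  refine le_antisymm (hcard ▸ vanLintSchrijverGraph_cliqueNum_mul_indepNum_le hodd) ?_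
  obtain ⟨K, hK, hclique, hindep⟩ := exists_subfield_isClique_isIndepSet he hodd hp ht
  obtain ⟨σ, hσ⟩ := exists_not_pow (F := GaloisField p ((e - 1) * t)) he.one_lt (by
    rw [hcard, ← ZMod.natCast_eq_zero_iff,
      Nat.cast_sub (Nat.one_le_pow _ _ (Fact.out : p.Prime).pos), Nat.cast_pow, pow_mul, ← hp,
      pow_orderOf_eq_one, one_pow, Nat.cast_one, sub_self])
  have hσ' : ¬ ∃ z, σ = z ^ e := fun ⟨z, hz⟩ => hσ ⟨z, hz.symm⟩
  have hσ0 : σ ≠ 0 := fun h => hσ ⟨0, by rw [h, zero_pow he.ne_zero]⟩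
  have h1 : Nat.card K ≤ (vanLintSchrijverGraph p e t hodd).cliqueNum := by
    have h := SimpleGraph.IsClique.card_le_cliqueNum
      (G := vanLintSchrijverGraph p e t hodd) (t := (K : Set _).toFinset)
      (tc := by rwa [Set.coe_toFinset])
    rwa [← Set.ncard_eq_toFinset_card'] at h
  have h2 : Nat.card K ≤ (vanLintSchrijverGraph p e t hodd).indepNum := by
    have h := SimpleGraph.IsIndepSet.card_le_indepNum
      (G := vanLintSchrijverGraph p e t hodd) (t := ((fun x => x * σ) '' (K : Set _)).toFinset)
      (by rw [Set.coe_toFinset]; exact hindep σ hσ')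
    rwa [← Set.ncard_eq_toFinset_card', Set.ncard_image_of_injective _ (mul_left_injective₀ hσ0)]
      at h
  rw [← hK, sq]
  exact Nat.mul_le_mul h1 h2

end vanLintSchrijver

theorem mainTheorem8 (p e t : ℕ) [Fact p.Prime] (he : e.Prime) (he_odd : Odd e)
    (hp : orderOf (p : ZMod e) = e - 1) (ht : 1 ≤ t) :
    ((vanLintSchrijverGraph p e t he_odd).IsSeparating ↔ Even t) ∧
    (Odd t →
      (∃ K : Subfield (GaloisField p ((e - 1) * t)),
        Nat.card K ^ 2 = p ^ ((e - 1) * t) ∧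
        (vanLintSchrijverGraph p e t he_odd).IsClique (K : Set (GaloisField p ((e - 1) * t))) ∧
        ∀ σ : GaloisField p ((e - 1) * t), (¬ ∃ z, σ = z ^ e) →
          (vanLintSchrijverGraph p e t he_odd).IsIndepSet ((fun x => x * σ) '' (K : Set _))) ∧
      (vanLintSchrijverGraph p e t he_odd).cliqueNum *
        (vanLintSchrijverGraph p e t he_odd).indepNum = p ^ ((e - 1) * t)) := by
  have hn0 : (e - 1) * t ≠ 0 := (Nat.mul_pos (Nat.sub_pos_of_lt he.one_lt) ht).ne'
  refine ⟨?_, fun hodd => ⟨exists_subfield_isClique_isIndepSet he he_odd hp hodd,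
    vanLintSchrijverGraph_cliqueNum_mul_indepNum_eq he he_odd hp hodd⟩⟩
  rw [SimpleGraph.IsSeparating, GaloisField.card p _ hn0]
  constructor
  · intro h
    by_contra hodd
    rw [Nat.not_even_iff_odd] at hodd
    exact h.ne (vanLintSchrijverGraph_cliqueNum_mul_indepNum_eq he he_odd hp hodd)
  · exact fun h => vanLintSchrijverGraph_cliqueNum_mul_indepNum_lt he he_odd hp h ht
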